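/- Let $\Omega=\{0,1\}^{\mathbb N}$; for a finite binary string $x$ let $[x]\subseteq\Omega$ be the set of infinite extensions of $x$, and let $\log$ be the binary logarithm. Let $\mu$ be a probability measure on $\Omega$ that is computable (there is an algorithm that, given a string $x$ and a rational $\varepsilon>0$, returns a rational $\varepsilon$-approximation of $\mu([x])$) and non-atomic ($\mu(\{\omega\})=0$ for every $\omega\in\Omega$). A function $t:\Omega\to[0,\infty]$ is *lower semicomputable* if, uniformly in a rational $r\ge 0$, one can enumerate a set of strings whose intervals have union $\{\omega: t(\omega)>r\}$; it is *probability bounded* if $\mu\{\omega:t(\omega)>r\}\le 1/r$ for all rational $r>0$. Let $\mathbf t^P_\mu$ be a largest, up to a multiplicative constant, lower semicomputable probability bounded function, and let $\mathbf d^P_\mu=\log \mathbf t^P_\mu$ (the probability bounded, or Martin-Löf, deficiency). A *continuous lower semicomputable semimeasure* is a function $a$ from binary strings to $[0,\infty)$ that is the limit of an increasing computable sequence of finitely supported rational-valued functions and satisfies $\sum_{x\in S}a(x)\le 1$ for every prefix-free set $S$ of strings. Let $\mathbf a$ be a largest, up to a multiplicative constant, such semimeasure, let $KA(x)=-\log\mathbf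 a(x)$, and let $$\mathbf d^A_\mu(\omega)=\sup_{n\ge 0}\bigl\{-\log\mu([\omega_{1\ldots n}])-KA(\omega_{1\ldots n})\bigr\}$$ (the a priori deficiency). **Theorem.** For every choice of $\mathbf t^P_\mu$ and $\mathbf a$ as above and for every real $c$ there exists $\omega\in\Omega$ such that $1<\mathbf d^P_\mu(\omega)<\infty$ and $$\mathbf d^A_\mu(\omega)<\mathbf d^P_\mu(\omega)-\log\mathbf d^P_\mu(\omega)-c .$$ -/

import Mathlib

open MeasureTheory Filter Topology
open scoped ENNReal NNReal

namespace RandomnessDeficiency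

noncomputable section

/-- The Cantor space of infinite binary sequences, with its product σ-algebra. -/
abbrev Cantor : Type := ℕ → Bool

/-- The initial segment of length `n` of `ω`. -/
def pre (ω : Cantor) (n : ℕ) : List Bool := (List.range n).map ω

/-- The interval `[x]`: all infinite extensions of the string `x`. -/
def interval (x : List Bool) : Set Cantor := {ω | pre ω x.length = x}

/-- A pair `(p, q)` of natural numbers codes the nonnegative rational number `p / (q + 1)`;
every nonnegative rational number has such a code. -/
def ratVal (r : ℕ × ℕ) : ℝ≥0 := (r.1 : ℝ≥0) / ((r.2 : ℝ≥0) + 1)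

/-- Computable measures: from a string `x` and `n` one computes a rational approximation of
`μ [x]` with error at most `1 / (n + 1)`. -/
def ComputableMeasure (μ : Measure Cantor) : Prop :=
  ∃ f : List Bool → ℕ → ℕ × ℕ, Computable₂ f ∧
    ∀ x n, |μ.real (interval x) - (ratVal (f x n) : ℝ)| ≤ 1 / ((n : ℝ) + 1)

/-! ### Functions on the Cantor space and the deficiency `dP` -/

/-- Lower semicomputable functions `Ω → [0, ∞]`: uniformly in the rational number `r` one can
enumerate a set of strings whose intervals have union `{ω | r < t ω}`. -/
def LowerSemicomputable (t : Cantor → ℝ≥0∞) : Prop :=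
  ∃ W : (ℕ × ℕ) × List Bool → Prop, REPred W ∧
    ∀ r : ℕ × ℕ, {ω | (ratVal r : ℝ≥0∞) < t ω} = ⋃ x ∈ {x | W (r, x)}, interval x

/-- Probability bounded functions: `μ {t > r} ≤ 1 / r` for all rational `r > 0`. -/
def ProbabilityBounded (μ : Measure Cantor) (t : Cantor → ℝ≥0∞) : Prop :=
  ∀ r : ℕ × ℕ, 0 < ratVal r → μ {ω | (ratVal r : ℝ≥0∞) < t ω} ≤ (ratVal r : ℝ≥0∞)⁻¹

/-- `t` is largest, up to a multiplicative constant, among the lower semicomputable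
probability bounded functions. -/
structure IsLargestProbabilityBounded (μ : Measure Cantor) (t : Cantor → ℝ≥0∞) : Prop where
  lowerSemicomputable : LowerSemicomputable t
  probabilityBounded : ProbabilityBounded μ t
  largest : ∀ s : Cantor → ℝ≥0∞, LowerSemicomputable s → ProbabilityBounded μ s →
    ∃ C : ℝ≥0, ∀ ω, s ω ≤ C * t ω

/-- Binary logarithm `[0, ∞] → [-∞, ∞]`. -/
def log2 (x : ℝ≥0∞) : EReal := ENNReal.log x / ((Real.log 2 : ℝ) : EReal)

/-- The probability bounded deficiency, the binary logarithm of `t`, where `t` is the largest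
lower semicomputable probability bounded function. -/
def dP (t : Cantor → ℝ≥0∞) (ω : Cantor) : EReal := log2 (t ω)

/-! ### Functions on strings and the deficiency `dA` -/

/-- The value at `x` of the basic (finitely supported, rational valued) function on strings that
is coded by the list `L` of pairs (argument, value); it is `0` at the strings not listed. -/
def basicVal (L : List (List Bool × (ℕ × ℕ))) (x : List Bool) : ℝ≥0 :=
  ratVal ((L.lookup x).getD (0, 0))

/-- Lower semicomputable functions on strings: limits of increasing computable sequences of
basic functions. As the functions considered are nonnegative, so may be the basic ones. -/
def LowerSemicomputableOnStrings (a : List Bool → ℝ≥0∞) : Prop :=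
  ∃ F : ℕ → List (List Bool × (ℕ × ℕ)), Computable F ∧
    ∀ x, Monotone (fun n => basicVal (F n) x) ∧
      Tendsto (fun n => (basicVal (F n) x : ℝ≥0∞)) atTop (𝓝 (a x))

/-- No element of `S` is a proper prefix of another one. -/
def PrefixFree (S : Set (List Bool)) : Prop :=
  ∀ x ∈ S, ∀ y ∈ S, x <+: y → x = y

/-- Continuous lower semicomputable semimeasures. -/
def IsContinuousSemimeasure (a : List Bool → ℝ≥0∞) : Prop :=
  LowerSemicomputableOnStrings a ∧
    ∀ S : Set (List Bool), PrefixFree S → ∑' x : S, a x ≤ 1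

/-- `a` is a continuous a priori probability: largest, up to a multiplicative constant, among
the continuous lower semicomputable semimeasures. -/
structure IsAPrioriProbability (a : List Bool → ℝ≥0∞) : Prop where
  isContinuousSemimeasure : IsContinuousSemimeasure a
  largest : ∀ b : List Bool → ℝ≥0∞, IsContinuousSemimeasure b →
    ∃ C : ℝ≥0, ∀ x, b x ≤ C * a x

/-- The a priori complexity of `x`, for the continuous a priori probability `a`. -/
def KA (a : List Bool → ℝ≥0∞) (x : List Bool) : EReal := -log2 (a x)

/-- The a priori deficiency, for the continuous a priori probability `a`. -/
def dA (μ : Measure Cantor) (a : List Bool → ℝ≥0∞) (ω : Cantor) : EReal :=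
  ⨆ n : ℕ, (-log2 (μ (interval (pre ω n))) - KA a (pre ω n))

end

end RandomnessDeficiency

namespace RandomnessDeficiency

/-! ### Strings and cylinders -/

/-! Let `U_k` be a computable sequence of sets, `U_k` determined by the first `m k` bits and of
measure at most `2^-(k+1)`, such that `U_(k+1)` occupies, up to a small error, at least the fraction
`2^-(k+3)` of every interval of length `m k` (`exists_computable_scattered`; non-atomicity makes
such sets exist, computability lets a search find them). The function equal to `2^k` on `U_k` is
lower semicomputable and probability bounded, so `dP` is at least `k - O(1)` on `U_k`.

A semimeasure cannot follow this so cheaply. Suppose that for all large `k` almost every point of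
`U_k` has a prefix with `a / μ ≥ 2^k / (B (k+1))`. Since `U_(k+1)` is scattered, most of it lies
outside whatever was covered at earlier scales, so the payments at different scales go to
incomparable strings and add up. Scale `k` costs at least a constant times `2^-k * 2^k / (B (k+1))`,
and the harmonic series diverges, against total weight at most `1` (`sum_le_one_of_covered`,
`frequently_not_covered`). So with positive probability some `U_k` contains a point with `dA ≤ k -
log (k+1) - log B`. Almost surely `dP` is not `⊤`, and a large `B` absorbs the constants. -/

@[simp] theorem length_pre (ω : Cantor) (n : ℕ) : (pre ω n).length = n := by simp [pre]

theorem take_pre (ω : Cantor) {n m : ℕ} (h : n ≤ m) : (pre ω m).take n = pre ω n := by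
  simp [pre, ← List.map_take, List.take_range, h]

theorem mem_interval {ω : Cantor} {x : List Bool} : ω ∈ interval x ↔ pre ω x.length = x := Iff.rfl

theorem mem_interval_pre (ω : Cantor) (n : ℕ) : ω ∈ interval (pre ω n) := by
  simp [mem_interval]

theorem pre_eq_of_mem_interval {ω : Cantor} {x : List Bool} (h : ω ∈ interval x) {n : ℕ}
    (hn : n ≤ x.length) : pre ω n = x.take n := by
  rw [← take_pre ω hn, mem_interval.1 h]

theorem exists_mem_interval (x : List Bool) : ∃ ω, ω ∈ interval x := by
  refine ⟨fun i => x.getD i false, ?_⟩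
  rw [mem_interval]
  refine List.ext_getElem (by simp) fun i _ h => ?_
  simp [pre, List.getElem?_eq_getElem h]

/-- The set of sequences whose initial segment of length `n` satisfies `P`. -/
def cylinder (n : ℕ) (P : List Bool → Prop) : Set Cantor := {ω | P (pre ω n)}

theorem mem_cylinder {n : ℕ} {P : List Bool → Prop} {ω : Cantor} :
    ω ∈ cylinder n P ↔ P (pre ω n) := Iff.rfl

theorem pre_eq_ofFn (ω : Cantor) (n : ℕ) : pre ω n = List.ofFn fun i : Fin n => ω i := by
  apply List.ext_getElem <;> simp [pre]

theorem cylinder_eq_preimage (n : ℕ) (P : List Bool → Prop) :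
    cylinder n P = (fun (ω : Cantor) (i : Fin n) => ω i) ⁻¹' {v | P (List.ofFn v)} := by
  ext ω; simp [cylinder, pre_eq_ofFn]

theorem measurableSet_cylinder (n : ℕ) (P : List Bool → Prop) : MeasurableSet (cylinder n P) := by
  rw [cylinder_eq_preimage]
  exact (by fun_prop : Measurable fun (ω : Cantor) (i : Fin n) => ω i)
    (Set.toFinite _).measurableSet

theorem isOpen_cylinder (n : ℕ) (P : List Bool → Prop) : IsOpen (cylinder n P) := by
  rw [cylinder_eq_preimage]
  exact (isOpen_discrete _).preimage (by fun_prop)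

theorem interval_eq_cylinder (x : List Bool) : interval x = cylinder x.length (· = x) := rfl

theorem measurableSet_interval (x : List Bool) : MeasurableSet (interval x) :=
  measurableSet_cylinder x.length (· = x)

theorem cylinder_eq_cylinder_of_le {n m : ℕ} (h : n ≤ m) (P : List Bool → Prop) :
    cylinder n P = cylinder m fun u => P (u.take n) := by
  ext ω; simp [cylinder, take_pre ω h]

theorem interval_inter_cylinder {x : List Bool} {m : ℕ} (h : x.length ≤ m) (P : List Bool → Prop) :
    interval x ∩ cylinder m P = cylinder m fun u => P u ∧ u.take x.length = x := by
  ext ω; simp [cylinder, mem_interval, take_pre ω h, and_comm]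

/-- The list of all strings of length `n`. -/
def strings : ℕ → List (List Bool)
  | 0 => [[]]
  | n + 1 => (strings n).flatMap fun x => [false :: x, true :: x]

theorem mem_strings {n : ℕ} {x : List Bool} : x ∈ strings n ↔ x.length = n := by
  induction n generalizing x with
  | zero => simp [strings]
  | succ n ih =>
    simp only [strings, List.mem_flatMap, ih, List.mem_cons, List.not_mem_nil, or_false]
    constructor
    · rintro ⟨y, hy, rfl | rfl⟩ <;> simp [hy]
    · intro h
      cases x with
      | nil => simp at h
      | cons b y => exact ⟨y, by simpa using h, by cases b <;> simp⟩

theorem nodup_strings (n : ℕ) : (strings n).Nodup := by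
  induction n with
  | zero => simp [strings]
  | succ n ih =>
    rw [strings, List.nodup_flatMap]
    refine ⟨fun x _ => by simp, ih.imp fun hxy => ?_⟩
    simp only [Function.onFun, List.disjoint_left, List.mem_cons, List.not_mem_nil, or_false]
    rintro z (rfl | rfl) h <;> simp_all

theorem length_strings (n : ℕ) : (strings n).length = 2 ^ n := by
  induction n with
  | zero => simp [strings]
  | succ n ih => simp [strings, List.length_flatMap, ih, pow_succ]

/-- The finite set of all strings of length `n`. -/
def level (n : ℕ) : Finset (List Bool) := (strings n).toFinset

@[simp] theorem mem_level {n : ℕ} {x : List Bool} : x ∈ level n ↔ x.length = n := by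
  simp [level, mem_strings]

@[simp] theorem card_level (n : ℕ) : (level n).card = 2 ^ n := by
  rw [level, List.toFinset_card_of_nodup (nodup_strings n), length_strings]

/-! ### Measures of cylinders -/

theorem measureReal_eq_sum_level (μ : Measure Cantor) [IsFiniteMeasure μ] (n : ℕ) {A : Set Cantor}
    (hA : MeasurableSet A) : μ.real A = ∑ x ∈ level n, μ.real (interval x ∩ A) := by
  rw [← measureReal_biUnion_finset]
  · congr 1
    ext ω
    simp only [Set.mem_iUnion, Set.mem_inter_iff, exists_prop, mem_level]
    exact ⟨fun h => ⟨pre ω n, by simp, mem_interval_pre ω n, h⟩, fun ⟨_, _, _, h⟩ => h⟩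
  · intro x hx y hy hxy
    simp only [Finset.mem_coe, mem_level] at hx hy
    refine Set.disjoint_left.2 fun ω h1 h2 => hxy ?_
    rw [← mem_interval.1 h1.1, ← mem_interval.1 h2.1, hx, hy]
  · exact fun x _ => (measurableSet_interval x).inter hA

theorem measureReal_cylinder (μ : Measure Cantor) [IsFiniteMeasure μ] (n : ℕ)
    (P : List Bool → Prop) [DecidablePred P] :
    μ.real (cylinder n P) = ∑ x ∈ level n, if P x then μ.real (interval x) else 0 := by
  rw [measureReal_eq_sum_level μ n (measurableSet_cylinder n P)]
  refine Finset.sum_congr rfl fun x hx => ?_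
  rw [mem_level] at hx
  subst hx
  split_ifs with h
  · congr 1
    exact Set.inter_eq_left.2 fun ω hω => by rw [mem_cylinder, mem_interval.1 hω]; exact h
  · rw [Set.eq_empty_of_forall_notMem (s := _ ∩ _), measureReal_empty]
    rintro ω ⟨h1, h2⟩
    exact h (by rwa [mem_cylinder, mem_interval.1 h1] at h2)

/-- The error `δ` is shared equally among the `2 ^ n` strings, so summing over any subfamily loses
at most `δ`; strings outside `P` only contribute a nonpositive term on the left. -/
theorem measureReal_inter_cylinder_ge (μ : Measure Cantor) [IsProbabilityMeasure μ] {n : ℕ}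
    {A : Set Cantor} (hA : MeasurableSet A) {w δ : ℝ} (hw : 0 ≤ w) (hδ : 0 ≤ δ)
    (h : ∀ x : List Bool, x.length = n →
      w * (μ.real (interval x) - δ / 2 ^ n) ≤ μ.real (interval x ∩ A))
    (P : List Bool → Prop) :
    w * (μ.real (cylinder n P) - δ) ≤ μ.real (cylinder n P ∩ A) := by
  classical
  have key : ∀ x ∈ level n, (w * ((if P x then μ.real (interval x) else 0) - δ / 2 ^ n)) ≤
      μ.real (interval x ∩ (cylinder n P ∩ A)) := by
    intro x hx
    rw [mem_level] at hx
    split_ifs with hP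
    · refine (h x hx).trans (measureReal_mono ?_)
      rintro ω ⟨h1, h2⟩
      refine ⟨h1, ?_, h2⟩
      rw [mem_cylinder, ← hx, mem_interval.1 h1]; exact hP
    · refine le_trans ?_ measureReal_nonneg
      have : 0 ≤ w * (δ / 2 ^ n) := by positivity
      linarith
  calc w * (μ.real (cylinder n P) - δ)
      = ∑ x ∈ level n, (w * ((if P x then μ.real (interval x) else 0) - δ / 2 ^ n)) := by
        rw [← Finset.mul_sum, Finset.sum_sub_distrib, ← measureReal_cylinder]
        simp [mul_div_cancel₀]
    _ ≤ _ := Finset.sum_le_sum key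
    _ = _ := (measureReal_eq_sum_level μ n ((measurableSet_cylinder n P).inter hA)).symm

/-! ### Consequences of non-atomicity -/

/-- The intervals of a non-atomic measure are uniformly small. -/
theorem exists_forall_measureReal_interval_lt (μ : Measure Cantor) [IsFiniteMeasure μ]
    (hna : ∀ ω : Cantor, μ {ω} = 0) {ε : ℝ} (hε : 0 < ε) (n : ℕ) :
    ∃ m, n ≤ m ∧ ∀ u : List Bool, u.length = m → μ.real (interval u) < ε := by
  let V : ℕ → Set Cantor := fun m => cylinder m fun u => μ.real (interval u) < ε
  have hanti : ∀ ω : Cantor, Antitone fun m => interval (pre ω m) := by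
    intro ω m m' h η hη
    have := pre_eq_of_mem_interval hη (n := m) (by simpa using h)
    rw [take_pre ω h] at this
    simpa [mem_interval] using this
  have hmono : Monotone V := fun m m' h ω hω =>
    lt_of_le_of_lt (measureReal_mono (hanti ω h)) hω
  have hcov : ∀ ω, ∃ m, ω ∈ V m := by
    intro ω
    have hInter : ⋂ m, interval (pre ω m) = {ω} := by
      ext η
      simp only [Set.mem_iInter, Set.mem_singleton_iff]
      constructor
      · intro h
        funext i
        have h1 := mem_interval.1 (h (i + 1))
        rw [length_pre] at h1
        have := congrArg (fun l => l[i]?) h1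
        simpa [pre] using this
      · rintro rfl m
        exact mem_interval_pre _ _
    have ht : Tendsto (fun m => μ (interval (pre ω m))) atTop (𝓝 (μ {ω})) := by
      rw [← hInter]
      exact tendsto_measure_iInter_atTop
        (fun m => (measurableSet_interval _).nullMeasurableSet) (hanti ω) ⟨0, measure_ne_top _ _⟩
    rw [hna ω] at ht
    obtain ⟨m, hm⟩ := (ht.eventually (gt_mem_nhds (ENNReal.ofReal_pos.2 hε))).exists
    exact ⟨m, by
      rw [mem_cylinder, Measure.real]
      exact (ENNReal.lt_ofReal_iff_toReal_lt (measure_ne_top _ _)).1 hm⟩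
  -- Compactness turns pointwise convergence into a uniform length, as in Dini's theorem: the `V m`
  -- are open, increasing, and cover the space.
  obtain ⟨m, hm⟩ := isCompact_univ.elim_directed_cover V (fun m => isOpen_cylinder m _)
    (fun ω _ => Set.mem_iUnion.2 (hcov ω)) hmono.directed_le
  refine ⟨max n m, le_max_left _ _, fun u hu => ?_⟩
  obtain ⟨ω, hω⟩ := exists_mem_interval u
  have := hmono (le_max_right n m) (hm (Set.mem_univ ω))
  rwa [mem_cylinder, ← hu, mem_interval.1 hω] at this

/-- Greedy choice: small nonnegative weights have partial sums close to any feasible target. -/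
theorem exists_subset_sum_near {ι : Type*} [DecidableEq ι] (T : Finset ι) (f : ι → ℝ) {ε τ : ℝ}
    (hε : ∀ i ∈ T, f i ≤ ε) (hε0 : 0 ≤ ε) (hτ0 : 0 ≤ τ) (hτ : τ ≤ ∑ i ∈ T, f i) :
    ∃ V ⊆ T, τ - ε ≤ ∑ i ∈ V, f i ∧ ∑ i ∈ V, f i ≤ τ := by
  induction T using Finset.induction_on with
  | empty => exact ⟨∅, by simp, by simp at hτ ⊢; linarith, by simpa using hτ0⟩
  | insert a T ha ih =>
    rw [Finset.sum_insert ha] at hτ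
    -- Either `a` is dispensable, or all of `T` undershoots the target by at most `f a ≤ ε`.
    rcases le_total τ (∑ i ∈ T, f i) with h | h
    · obtain ⟨V, hV, h'⟩ := ih (fun i hi => hε i (Finset.mem_insert_of_mem hi)) h
      exact ⟨V, hV.trans (Finset.subset_insert _ _), h'⟩
    · exact ⟨T, Finset.subset_insert _ _, by
        linarith [hε a (Finset.mem_insert_self _ _)], h⟩

/-- A non-atomic measure admits a cylinder that occupies approximately a given fraction of each
interval of a given length. -/
theorem exists_cylinder_fraction (μ : Measure Cantor) [IsFiniteMeasure μ]
    (hna : ∀ ω : Cantor, μ {ω} = 0) {w ε : ℝ} (hw : 0 ≤ w) (hw1 : w ≤ 1) (hε : 0 < ε) (n : ℕ) :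
    ∃ m, n ≤ m ∧ ∃ L : List (List Bool), ∀ x : List Bool, x.length = n →
      w * μ.real (interval x) - ε ≤ μ.real (interval x ∩ cylinder m (· ∈ L)) ∧
      μ.real (interval x ∩ cylinder m (· ∈ L)) ≤ w * μ.real (interval x) := by
  classical
  obtain ⟨m, hnm, hm⟩ := exists_forall_measureReal_interval_lt μ hna hε n
  refine ⟨m, hnm, ?_⟩
  have hT : ∀ x : List Bool, x.length = n → μ.real (interval x) =
      ∑ u ∈ (level m).filter (fun u => u.take n = x), μ.real (interval u) := by
    rintro x rfl
    rw [Finset.sum_filter, interval_eq_cylinder, cylinder_eq_cylinder_of_le hnm, measureReal_cylinder]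
  have key : ∀ x : List Bool, ∃ V ⊆ (level m).filter (fun u => u.take n = x),
      x.length = n → w * μ.real (interval x) - ε ≤ ∑ u ∈ V, μ.real (interval u) ∧
        ∑ u ∈ V, μ.real (interval u) ≤ w * μ.real (interval x) := by
    intro x
    by_cases hx : x.length = n
    · obtain ⟨V, hV, h⟩ := exists_subset_sum_near ((level m).filter (fun u => u.take n = x))
        (fun u => μ.real (interval u)) (ε := ε) (τ := w * μ.real (interval x))
        (fun u hu => (hm u (mem_level.1 (Finset.mem_filter.1 hu).1)).le) hε.le
        (mul_nonneg hw measureReal_nonneg)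
        (by rw [← hT x hx]; exact mul_le_of_le_one_left measureReal_nonneg hw1)
      exact ⟨V, hV, fun _ => h⟩
    · exact ⟨∅, by simp, fun h => absurd h hx⟩
  choose V hVs hV using key
  refine ⟨((level n).biUnion V).toList, ?_⟩
  rintro x rfl
  have : μ.real (interval x ∩ cylinder m (· ∈ ((level x.length).biUnion V).toList)) =
      ∑ u ∈ V x, μ.real (interval u) := by
    rw [interval_inter_cylinder hnm, measureReal_cylinder, ← Finset.sum_filter]
    refine Finset.sum_congr ?_ fun _ _ => rfl
    ext u
    simp only [Finset.mem_filter, mem_level, Finset.mem_toList, Finset.mem_biUnion]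
    constructor
    · rintro ⟨-, ⟨y, -, hu⟩, hx⟩
      have := (Finset.mem_filter.1 (hVs y hu)).2
      rw [hx] at this
      rwa [this]
    · intro hu
      have := Finset.mem_filter.1 (hVs x hu)
      exact ⟨mem_level.1 this.1, ⟨x, rfl, hu⟩, this.2⟩
  rw [this]
  exact hV x rfl

/-! ### The cost of covering scattered sets by a semimeasure -/

/-- The minimal strings among those that meet `R` and on which the ratio `a / μ` is at
least `l`. -/
def minimalStrings (μ : Measure Cantor) (a : List Bool → ℝ≥0∞) (l : ℝ≥0) (R : Set Cantor) :
    Set (List Bool) :=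
  {x | (R ∩ interval x).Nonempty ∧ l * μ (interval x) ≤ a x ∧
    ∀ n < x.length, ¬ l * μ (interval (x.take n)) ≤ a (x.take n)}

theorem prefixFree_minimalStrings (μ : Measure Cantor) (a : List Bool → ℝ≥0∞) (l : ℝ≥0)
    (R : Set Cantor) : PrefixFree (minimalStrings μ a l R) := by
  intro x hx y hy hxy
  have hx' := List.prefix_iff_eq_take.1 hxy
  rcases hxy.length_le.lt_or_eq with h | h
  · refine absurd ?_ (hy.2.2 _ h)
    rw [← hx']; exact hx.2.1
  · exact hxy.eq_of_length h

/-- Each point of `R` passes through its shortest prefix with ratio at least `l`, so the minimal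
strings cover `R`. -/
theorem mul_measure_le_tsum_minimalStrings (μ : Measure Cantor) (a : List Bool → ℝ≥0∞) (l : ℝ≥0)
    (R : Set Cantor) (hR : ∀ ω ∈ R, ∃ n, l * μ (interval (pre ω n)) ≤ a (pre ω n)) :
    l * μ R ≤ ∑' x : minimalStrings μ a l R, a x := by
  classical
  have hsub : R ⊆ ⋃ x ∈ minimalStrings μ a l R, interval x := by
    intro ω hω
    have h := hR ω hω
    refine Set.mem_biUnion (x := pre ω (Nat.find h)) ⟨⟨ω, hω, mem_interval_pre _ _⟩,
      Nat.find_spec h, fun n hn => ?_⟩ (mem_interval_pre _ _)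
    rw [length_pre] at hn
    rw [take_pre ω hn.le]
    exact Nat.find_min h hn
  calc l * μ R ≤ l * ∑' x : minimalStrings μ a l R, μ (interval x) := by
        gcongr
        exact (measure_mono hsub).trans (measure_biUnion_le μ (Set.to_countable _) _)
    _ = ∑' x : minimalStrings μ a l R, l * μ (interval x) := ENNReal.tsum_mul_left.symm
    _ ≤ _ := ENNReal.tsum_le_tsum fun x => x.2.2.1

/-- A maximal inequality of Ville's type: the minimal strings with large ratio are prefix-free, so
their total `a`-weight is at most `1`. -/
theorem measureReal_exists_ratio_ge_le (μ : Measure Cantor)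
    {a : List Bool → ℝ≥0∞} (ha : ∀ S : Set (List Bool), PrefixFree S → ∑' x : S, a x ≤ 1)
    {l : ℝ≥0} (hl : 0 < l) :
    μ.real {ω | ∃ n, l * μ (interval (pre ω n)) ≤ a (pre ω n)} ≤ 1 / l := by
  have h := (mul_measure_le_tsum_minimalStrings μ a l
    {ω | ∃ n, l * μ (interval (pre ω n)) ≤ a (pre ω n)} fun _ h => h).trans
    (ha _ (prefixFree_minimalStrings μ a l _))
  have h' := ENNReal.toReal_mono ENNReal.one_ne_top h
  rw [ENNReal.toReal_mul] at h'
  rw [le_div_iff₀ (by exact_mod_cast hl), mul_comm]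
  simpa [Measure.real] using h'

theorem tsum_biUnion_eq_sum {α : Type*} (a : α → ℝ≥0∞) (s : Finset ℕ) (S : ℕ → Set α)
    (h : ∀ i ∈ s, ∀ j ∈ s, i < j → Disjoint (S i) (S j)) :
    ∑' x : ⋃ i ∈ s, S i, a x = ∑ i ∈ s, ∑' x : S i, a x := by
  have hd : (↑s : Set ℕ).PairwiseDisjoint S := by
    intro i hi j hj hij
    rcases hij.lt_or_gt with h1 | h1
    · exact h i hi j hj h1
    · exact (h j hj i hi h1).symm
  refine (ENNReal.tsum_biUnion' (f := a) hd).trans ?_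
  exact Finset.tsum_subtype' s fun i => ∑' x : S i, a x

/-- If almost all points of the scattered sets `U k` get the ratio at least `l k` from the
semimeasure `a`, then its total weight is bounded from below by a sum over all scales. -/
theorem sum_le_one_of_covered (μ : Measure Cantor) [IsProbabilityMeasure μ]
    {a : List Bool → ℝ≥0∞} (ha : ∀ S : Set (List Bool), PrefixFree S → ∑' x : S, a x ≤ 1)
    {m : ℕ → ℕ} (hm : Monotone m) (Q : ℕ → List Bool → Prop)
    (hup : ∀ k, μ.real (cylinder (m k) (Q k)) ≤ (1 / 2) ^ (k + 1))
    (hlow : ∀ k P, (1 / 2 : ℝ) ^ (k + 3) * (μ.real (cylinder (m k) P) - 1 / 4) ≤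
      μ.real (cylinder (m k) P ∩ cylinder (m (k + 1)) (Q (k + 1))))
    {l : ℕ → ℝ≥0} (hl : ∀ k, 0 < l k) (hlm : Monotone l) (k₀ : ℕ)
    (hsmall : ∀ K, ∑ j ∈ Finset.Ico k₀ K, (1 / (l j : ℝ) + (1 / 2) ^ (j + 1)) ≤ 1 / 2)
    (hcov : ∀ᵐ ω ∂μ, ∀ k ≥ k₀, Q k (pre ω (m k)) →
      ∃ n, l k * μ (interval (pre ω n)) ≤ a (pre ω n)) (K : ℕ) :
    ∑ i ∈ Finset.Ico k₀ K, (l (i + 1) : ℝ) * ((1 / 2) ^ (i + 3) * (1 / 4)) ≤ 1 := by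
  classical
  -- The points spoiled at scale `j`: those already rich within the first `m j` bits, and those of
  -- `U_j` itself. Scale `i + 1` will be charged only on points unspoiled at all scales from `k₀` to
  -- `i`.
  let G : ℕ → List Bool → Prop := fun j u =>
    (∃ n ≤ m j, l j * μ (interval (u.take n)) ≤ a (u.take n)) ∨ Q j u
  have hGμ : ∀ j, μ.real (cylinder (m j) (G j)) ≤ 1 / (l j : ℝ) + (1 / 2) ^ (j + 1) := by
    intro j
    have hsub : cylinder (m j) (G j) ⊆
        {ω | ∃ n, l j * μ (interval (pre ω n)) ≤ a (pre ω n)} ∪ cylinder (m j) (Q j) := by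
      rintro ω (⟨n, hn, h⟩ | h)
      · rw [take_pre ω hn] at h
        exact Or.inl ⟨n, h⟩
      · exact Or.inr h
    calc _ ≤ _ := measureReal_mono hsub
      _ ≤ _ := measureReal_union_le _ _
      _ ≤ _ := add_le_add (measureReal_exists_ratio_ge_le μ ha (hl j)) (hup j)
  let E : ℕ → Set Cantor := fun i =>
    cylinder (m i) fun u => ∀ j ∈ Finset.Ico k₀ (i + 1), ¬ G j (u.take (m j))
  have hE : ∀ i ω, ω ∈ E i ↔ ∀ j, k₀ ≤ j → j ≤ i → ω ∉ cylinder (m j) (G j) := by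
    intro i ω
    simp only [E, mem_cylinder, Finset.mem_Ico, and_imp, Nat.lt_succ_iff]
    refine forall_congr' fun j => forall_congr' fun _ => forall_congr' fun h => ?_
    rw [take_pre ω (hm h)]
  have hEμ : ∀ i, 1 / 2 ≤ μ.real (E i) := by
    intro i
    have hsub : (E i)ᶜ ⊆ ⋃ j ∈ Finset.Ico k₀ (i + 1), cylinder (m j) (G j) := by
      intro ω hω
      rw [Set.mem_compl_iff, hE] at hω
      push Not at hω
      obtain ⟨j, h1, h2, h3⟩ := hω
      exact Set.mem_biUnion (Finset.mem_coe.2 (Finset.mem_Ico.2 ⟨h1, by omega⟩)) h3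
    have h1 : μ.real (E i)ᶜ ≤ 1 / 2 :=
      calc _ ≤ _ := measureReal_mono hsub (measure_ne_top _ _)
        _ ≤ _ := measureReal_biUnion_finset_le _ _
        _ ≤ _ := Finset.sum_le_sum fun j _ => hGμ j
        _ ≤ _ := hsmall _
    rw [probReal_compl_eq_one_sub (measurableSet_cylinder _ _)] at h1
    linarith
  let N : Set Cantor := {ω | ∀ k ≥ k₀, Q k (pre ω (m k)) →
      ∃ n, l k * μ (interval (pre ω n)) ≤ a (pre ω n)}
  let R : ℕ → Set Cantor := fun i => E i ∩ cylinder (m (i + 1)) (Q (i + 1)) ∩ N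
  let S : ℕ → Set (List Bool) := fun i => minimalStrings μ a (l (i + 1)) (R i)
  -- `E i` is decided by the first `m i` bits, so scattering applies to it; `1 / 4` is its measure
  -- `1 / 2` less the scattering error `1 / 4`.
  have hRμ : ∀ i, (1 / 2 : ℝ) ^ (i + 3) * (1 / 4) ≤ μ.real (R i) := by
    intro i
    have h1 : μ.real (R i) = μ.real (E i ∩ cylinder (m (i + 1)) (Q (i + 1))) := by
      refine measureReal_congr (inter_ae_eq_left_of_ae_eq_univ ?_)
      exact eventuallyEq_univ.2 hcov
    rw [h1]
    refine le_trans ?_ (hlow i _)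
    gcongr
    have := hEμ i
    simp only [E] at this
    linarith
  -- A shorter `y` would have ratio at least `l (i + 1) ≥ l j` within `m j` bits, spoiling the point
  -- of `R i` that extends it.
  have hlen : ∀ i, k₀ ≤ i → ∀ y ∈ S i, ∀ j, k₀ ≤ j → j ≤ i → m j < y.length := by
    rintro i hi y ⟨⟨η, hη, hηy⟩, hy, -⟩ j hj hji
    by_contra! hlt
    refine (hE i η).1 hη.1.1 j hj hji (Or.inl ⟨y.length, hlt, ?_⟩)
    rw [take_pre η hlt, mem_interval.1 hηy]
    refine le_trans ?_ hy
    gcongr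
    exact hlm (by omega)
  have hcross : ∀ i j, k₀ ≤ i → i < j → ∀ x ∈ S i, ∀ y ∈ S j, ¬ (x <+: y ∨ y <+: x) := by
    intro i j hi hij x hx y hy hcomp
    have hylen := hlen j (by omega) y hy (i + 1) (by omega) (by omega)
    obtain ⟨⟨ω, hω, hωx⟩, hxr, -⟩ := hx
    obtain ⟨⟨η, hη, hηy⟩, hyr, -⟩ := hy
    have hηG := (hE j η).1 hη.1.1 (i + 1) (by omega) (by omega)
    -- If `x` is short, it is a rich prefix of `η`; if long, `η` shares its first `m (i + 1)` bits
    -- with a point of `U_(i+1)`. Both spoil `η` at scale `i + 1`.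
    rcases le_or_gt x.length (m (i + 1)) with h | h
    · rcases hcomp with hc | hc
      · refine hηG (Or.inl ⟨x.length, h, ?_⟩)
        rw [take_pre η h, pre_eq_of_mem_interval hηy hc.length_le,
          ← List.prefix_iff_eq_take.1 hc]
        exact hxr
      · have := hc.length_le
        omega
    · refine hηG (Or.inr ?_)
      have h1 := pre_eq_of_mem_interval hωx h.le
      have h2 := pre_eq_of_mem_interval hηy hylen.le
      have h3 : x.take (m (i + 1)) = y.take (m (i + 1)) := by
        rcases hcomp with hc | hc
        · rw [List.prefix_iff_eq_take.1 hc, List.take_take, min_eq_left h.le]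
        · rw [List.prefix_iff_eq_take.1 hc, List.take_take, min_eq_left hylen.le]
      rw [h2, ← h3, ← h1]
      exact hω.1.2
  have hpf : PrefixFree (⋃ i ∈ Finset.Ico k₀ K, S i) := by
    intro x hx y hy hxy
    simp only [Set.mem_iUnion, exists_prop, Finset.mem_Ico] at hx hy
    obtain ⟨i, hi, hx⟩ := hx
    obtain ⟨j, hj, hy⟩ := hy
    rcases lt_trichotomy i j with h | rfl | h
    · exact absurd (Or.inl hxy) (hcross i j hi.1 h x hx y hy)
    · exact prefixFree_minimalStrings _ _ _ _ x hx y hy hxy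
    · exact absurd (Or.inr hxy) (hcross j i hj.1 h y hy x hx)
  have htot := ha _ hpf
  rw [tsum_biUnion_eq_sum] at htot
  · have hle : ∀ i ∈ Finset.Ico k₀ K,
        ENNReal.ofReal ((l (i + 1) : ℝ) * ((1 / 2) ^ (i + 3) * (1 / 4))) ≤ ∑' x : S i, a x := by
      intro i hi
      refine le_trans ?_ (mul_measure_le_tsum_minimalStrings μ a (l (i + 1)) (R i) ?_)
      · rw [ENNReal.ofReal_mul (by positivity), ENNReal.ofReal_coe_nnreal]
        gcongr
        exact ENNReal.ofReal_le_of_le_toReal (hRμ i)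
      · intro ω hω
        have := (Finset.mem_Ico.1 hi).1
        exact hω.2 (i + 1) (by omega) hω.1.2
    have := (Finset.sum_le_sum hle).trans htot
    rw [← ENNReal.ofReal_sum_of_nonneg fun i _ => by positivity] at this
    exact ENNReal.ofReal_le_one.1 this
  · intro i hi j hj hij
    refine Set.disjoint_left.2 fun x hx hy => ?_
    exact hcross i j (Finset.mem_Ico.1 hi).1 hij x hx x hy (Or.inl List.prefix_rfl)

/-! ### Divergence of the total cost -/

/-- The ratio `2 ^ k / (B * (k + 1))`. -/
noncomputable def ratio (B : ℝ≥0) (k : ℕ) : ℝ≥0 := 2 ^ k / (B * (k + 1))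

theorem ratio_pos {B : ℝ≥0} (hB : 0 < B) (k : ℕ) : 0 < ratio B k := by
  unfold ratio; positivity

theorem monotone_ratio {B : ℝ≥0} (hB : 0 < B) : Monotone (ratio B) := by
  refine monotone_nat_of_le_succ fun k => ?_
  unfold ratio
  rw [div_le_div_iff₀ (by positivity) (by positivity), ← NNReal.coe_le_coe]
  push_cast
  have h1 : (0 : ℝ) ≤ 2 ^ k * B * k := by positivity
  rw [pow_succ]
  nlinarith

/-- The terms are of order `(j + 1) / 2 ^ j`, hence summable: starting late enough, the spoiled
points have total measure at most `1 / 2`. -/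
theorem exists_sum_inv_ratio_le (B : ℝ≥0) : ∃ k₁, ∀ k₀ ≥ k₁, ∀ K,
    ∑ j ∈ Finset.Ico k₀ K, (1 / (ratio B j : ℝ) + (1 / 2) ^ (j + 1)) ≤ 1 / 2 := by
  have hs : Summable fun j : ℕ => 1 / (ratio B j : ℝ) + (1 / 2) ^ (j + 1) := by
    have h1 : Summable fun j : ℕ => ((j : ℝ) ^ 1 * (1 / 2) ^ j) :=
      summable_pow_mul_geometric_of_norm_lt_one 1 (by norm_num)
    have h0 : Summable fun j : ℕ => ((1 / 2 : ℝ) ^ j) := summable_geometric_two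
    have h2 := ((h1.mul_left (B : ℝ)).add (h0.mul_left (B : ℝ))).add (h0.mul_right (1 / 2))
    refine h2.congr fun j => ?_
    simp only [ratio]
    push_cast
    rw [one_div_div, pow_succ, one_div_pow, one_div_pow]
    ring
  have ht := tendsto_sum_nat_add fun j : ℕ => 1 / (ratio B j : ℝ) + (1 / 2) ^ (j + 1)
  obtain ⟨k₁, hk₁⟩ := eventually_atTop.1 (ht.eventually (gt_mem_nhds (by norm_num : (0 : ℝ) < 1 / 2)))
  refine ⟨k₁, fun k₀ hk K => le_trans ?_ (hk₁ k₀ hk).le⟩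
  rw [Finset.sum_Ico_eq_sum_range]
  simp_rw [add_comm k₀]
  exact ((summable_nat_add_iff k₀).2 hs).sum_le_tsum _ fun i _ => by positivity

theorem frequently_not_covered (μ : Measure Cantor) [IsProbabilityMeasure μ]
    {a : List Bool → ℝ≥0∞} (ha : ∀ S : Set (List Bool), PrefixFree S → ∑' x : S, a x ≤ 1)
    {m : ℕ → ℕ} (hm : Monotone m) (Q : ℕ → List Bool → Prop)
    (hup : ∀ k, μ.real (cylinder (m k) (Q k)) ≤ (1 / 2) ^ (k + 1))
    (hlow : ∀ k P, (1 / 2 : ℝ) ^ (k + 3) * (μ.real (cylinder (m k) P) - 1 / 4) ≤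
      μ.real (cylinder (m k) P ∩ cylinder (m (k + 1)) (Q (k + 1))))
    {B : ℝ≥0} (hB : 0 < B) (k₀ : ℕ) :
    ∃ᵐ ω ∂μ, ∃ k ≥ k₀, Q k (pre ω (m k)) ∧
      ∀ n, a (pre ω n) < ratio B k * μ (interval (pre ω n)) := by
  intro hcon
  obtain ⟨k₁, hk₁⟩ := exists_sum_inv_ratio_le B
  have hcov : ∀ᵐ ω ∂μ, ∀ k ≥ max k₀ k₁, Q k (pre ω (m k)) →
      ∃ n, ratio B k * μ (interval (pre ω n)) ≤ a (pre ω n) := by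
    filter_upwards [hcon] with ω hω k hk hQ
    by_contra! h
    exact hω ⟨k, (le_max_left _ _).trans hk, hQ, h⟩
  have hsum := sum_le_one_of_covered μ ha hm Q hup hlow (ratio_pos hB) (monotone_ratio hB)
    (max k₀ k₁) (hk₁ _ (le_max_right _ _)) hcov
  have hns : ¬ Summable fun n : ℕ => 1 / (n : ℝ) := Real.not_summable_one_div_natCast
  -- The cost of scale `i + 1` is `1 / (16 B (i + 2))`; hence the shift by `2` and the bound `16 *
  -- B`.
  refine hns ((summable_nat_add_iff (max k₀ k₁ + 2)).1 ?_)
  refine summable_of_sum_range_le (c := 16 * B) (fun n => by positivity) fun n => ?_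
  have h := hsum (max k₀ k₁ + n)
  rw [Finset.sum_Ico_eq_sum_range, Nat.add_sub_cancel_left] at h
  have hB' : (0 : ℝ) < B := hB
  calc _ = (16 * B) * ∑ i ∈ Finset.range n, (ratio B (max k₀ k₁ + i + 1) : ℝ) *
        ((1 / 2) ^ (max k₀ k₁ + i + 3) * (1 / 4)) := by
        rw [Finset.mul_sum]
        refine Finset.sum_congr rfl fun i _ => ?_
        simp only [ratio]
        push_cast
        rw [one_div_pow, pow_add 2 _ 3, pow_add 2 _ 1]
        field_simp
        ring
    _ ≤ (16 * B) * 1 := by gcongr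
    _ = _ := mul_one _

/-! ### Computability tools -/

section Computability

variable {α β σ : Type*} [Primcodable α] [Primcodable β] [Primcodable σ]

theorem computable_foldl {f : α → List β} {g : α → σ} {h : α → σ × β → σ} (hf : Computable f)
    (hg : Computable g) (hh : Computable₂ h) :
    Computable fun a => (f a).foldl (fun s b => h a (s, b)) (g a) := by
  have hstep : Computable₂ fun (a : α) (p : ℕ × σ) =>
      (Option.casesOn (f a)[p.1]? p.2 fun b => h a (p.2, b) : σ) :=
    Computable.option_casesOn
      (Computable.list_getElem?.comp (hf.comp Computable.fst) (Computable.fst.comp Computable.snd))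
      (Computable.snd.comp Computable.snd)
      (hh.comp (Computable.fst.comp Computable.fst)
        ((Computable.snd.comp (Computable.snd.comp Computable.fst)).pair Computable.snd))
  refine (Computable.nat_rec (Computable.list_length.comp hf) hg hstep).of_eq fun a => ?_
  have key : ∀ n, (Nat.rec (g a) (fun i s => (Option.casesOn (f a)[i]? s fun b => h a (s, b) : σ)) n : σ)
      = ((f a).take n).foldl (fun s b => h a (s, b)) (g a) := by
    intro n
    induction n with
    | zero => simp
    | succ n ih =>
      rw [List.take_add_one, List.foldl_append, ← ih]
      cases hc : (f a)[n]? <;> simp [hc]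
  simpa using key (f a).length

theorem computable_sum_map {f : α → List β} {g : α → β → ℕ} (hf : Computable f)
    (hg : Computable₂ g) : Computable fun a => ((f a).map (g a)).sum := by
  have hh : Computable₂ fun (a : α) (p : ℕ × β) => p.1 + g a p.2 :=
    Primrec.nat_add.to_comp.comp (Computable.fst.comp Computable.snd)
      (hg.comp Computable.fst (Computable.snd.comp Computable.snd))
  refine (computable_foldl hf (Computable.const 0) hh).of_eq fun a => ?_
  rw [List.sum_eq_foldl, List.foldl_map]

theorem computable_all {f : α → List β} {p : α → β → Bool} (hf : Computable f)
    (hp : Computable₂ p) : Computable fun a => (f a).all (p a) := by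
  have hh : Computable₂ fun (a : α) (q : Bool × β) => q.1 && p a q.2 :=
    Primrec.and.to_comp.comp (Computable.fst.comp Computable.snd)
      (hp.comp Computable.fst (Computable.snd.comp Computable.snd))
  refine (computable_foldl hf (Computable.const true) hh).of_eq fun a => ?_
  have key : ∀ (l : List β) (b : Bool), l.foldl (fun s x => s && p a x) b = (b && l.all (p a)) := by
    intro l
    induction l with
    | nil => simp
    | cons x l ih => intro b; simp [ih, Bool.and_assoc]
  simpa using key (f a) true

/-- A total decidable relation has a computable choice function. -/
theorem exists_computable_choice {p : α → β → Bool} (hp : Computable₂ p) (h : ∀ a, ∃ b, p a b) :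
    ∃ f : α → β, Computable f ∧ ∀ a, p a (f a) := by
  classical
  -- Unbounded search through the codes of elements of `β`.
  let F : α → ℕ → Option β := fun a n =>
    (Encodable.decode n : Option β).bind fun b => bif p a b then some b else none
  have hF : Computable₂ F :=
    Computable.option_bind (Computable.decode.comp Computable.snd)
      (Computable.cond (hp.comp (Computable.fst.comp Computable.fst) Computable.snd)
        (Computable.option_some.comp Computable.snd) (Computable.const none))
  have hF' : ∀ a n b, b ∈ F a n → p a b := by
    intro a n b hb
    simp only [F, Option.mem_def, Option.bind_eq_some_iff] at hb
    obtain ⟨b', -, h'⟩ := hb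
    cases hpb : p a b' <;> simp_all
  have hdom : ∀ a, (Nat.rfindOpt (F a)).Dom := by
    intro a
    obtain ⟨b, hb⟩ := h a
    exact Nat.rfindOpt_dom.2 ⟨Encodable.encode b, b, by simp [F, hb]⟩
  refine ⟨fun a => (Nat.rfindOpt (F a)).get (hdom a),
    (Partrec.rfindOpt hF).of_eq_tot fun a => Part.get_mem _, fun a => ?_⟩
  obtain ⟨n, hn⟩ := Nat.rfindOpt_spec (Part.get_mem (hdom a))
  exact hF' a n _ hn

theorem rePred_exists_nat {p : α → ℕ → Bool} (hp : Computable₂ p) :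
    REPred fun a => ∃ n, p a n := by
  refine (Partrec.dom_re (Partrec.rfind hp.partrec₂)).of_eq fun a => ?_
  rw [Nat.rfind_dom']
  constructor
  · rintro ⟨n, hn, -⟩
    exact ⟨n, by simpa using hn⟩
  · rintro ⟨n, hn⟩
    exact ⟨n, by simpa using hn, by simp⟩

end Computability

theorem primrec_pow : Primrec₂ ((· ^ ·) : ℕ → ℕ → ℕ) :=
  Primrec₂.unpaired'.1 Nat.Primrec.pow

theorem primrec_strings : Primrec strings := by
  have hstep : Primrec₂ fun (_ : ℕ) (L : List (List Bool)) =>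
      L.flatMap fun x => [false :: x, true :: x] := by
    refine Primrec.list_flatMap Primrec.snd (Primrec₂.mk ?_)
    exact Primrec.list_cons.comp (Primrec.list_cons.comp (Primrec.const false) Primrec.snd)
      (Primrec.list_cons.comp (Primrec.list_cons.comp (Primrec.const true) Primrec.snd)
        (Primrec.const []))
  refine (Primrec.nat_rec₁ [[]] hstep).of_eq fun n => ?_
  induction n with
  | zero => rfl
  | succ n ih => simp only [strings, ← ih]

theorem primrecRel_mem {α : Type*} [Primcodable α] :
    PrimrecRel fun (L : List α) (x : α) => x ∈ L :=
  (PrimrecRel.exists_mem_list (R := Eq) Primrec.eq).of_eq fun L x => by simp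

/-- Integer approximations keep the later tests within arithmetic on `ℕ`. One unit of error comes
from the rational approximation, one from rounding down. -/
theorem ComputableMeasure.exists_nat_approx {μ : Measure Cantor} (hμ : ComputableMeasure μ) :
    ∃ g : List Bool → ℕ → ℕ, Computable₂ g ∧
      ∀ x (M : ℕ), |((M : ℝ) + 1) * μ.real (interval x) - g x M| ≤ 2 := by
  obtain ⟨f, hf, h⟩ := hμ
  refine ⟨fun x M => (f x M).1 * (M + 1) / ((f x M).2 + 1), ?_, fun x M => ?_⟩
  · exact Primrec.nat_div.to_comp.comp
      (Primrec.nat_mul.to_comp.comp (Computable.fst.comp hf)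
        (Computable.succ.comp Computable.snd))
      (Computable.succ.comp (Computable.snd.comp hf))
  · have h1 := h x M
    have hM : (0 : ℝ) < (M : ℝ) + 1 := by positivity
    set p := (f x M).1
    set q := (f x M).2
    have hval : (ratVal (f x M) : ℝ) = p / ((q : ℝ) + 1) := by simp [ratVal, p, q]
    rw [hval] at h1
    have hq : (0 : ℝ) < (q : ℝ) + 1 := by positivity
    have hfl1 : ((p * (M + 1) / (q + 1) : ℕ) : ℝ) ≤ p * (M + 1) / (q + 1) := by
      refine Nat.cast_div_le.trans_eq ?_
      push_cast; rfl
    have hfl2 : (p : ℝ) * (M + 1) / (q + 1) ≤ ((p * (M + 1) / (q + 1) : ℕ) : ℝ) + 1 := by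
      rw [div_le_iff₀ hq]
      have := Nat.lt_div_mul_add (a := p * (M + 1)) (b := q + 1) (by omega)
      have h' : p * (M + 1) ≤ (p * (M + 1) / (q + 1) + 1) * (q + 1) := by
        rw [add_mul, one_mul]; exact this.le
      exact_mod_cast h'
    have h2 : |((M : ℝ) + 1) * μ.real (interval x) - p * (M + 1) / (q + 1)| ≤ 1 := by
      have : ((M : ℝ) + 1) * μ.real (interval x) - p * (M + 1) / (q + 1) =
          (M + 1) * (μ.real (interval x) - p / (q + 1)) := by ring
      rw [this, abs_mul, abs_of_pos hM]
      calc _ ≤ ((M : ℝ) + 1) * (1 / (M + 1)) := by gcongr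
        _ = 1 := by field_simp
    rw [abs_le] at h2 ⊢
    constructor <;> linarith [h2.1, h2.2]

/-! ### The search for scattered sets -/

/-- The approximate mass, in units of `1 / (M + 1)`, of the strings of length `m` that belong
to `L` and extend `x`. -/
def mass (g : List Bool → ℕ → ℕ) (M m : ℕ) (L : List (List Bool)) (x : List Bool) : ℕ :=
  ((strings m).map fun u =>
    bif decide (u ∈ L) && decide (u.take x.length = x) then g u M else 0).sum

/-- The test that the strings of length `z.1` in the list `z.2.2` form a small set, scattered
over the intervals of length `p.2`. -/
def scatterTest (g : List Bool → ℕ → ℕ) (p : ℕ × ℕ) (z : ℕ × ℕ × List (List Bool)) : Bool :=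
  decide (p.2 ≤ z.1) &&
  (decide (2 ^ (p.1 + 1) * (mass g z.2.1 z.1 z.2.2 [] + 2 * 2 ^ z.1) ≤ z.2.1 + 1) &&
  (strings p.2).all fun x => decide
    (2 ^ (p.1 + 2) * (4 * 2 ^ p.2) * (2 * 2 ^ z.1) + 4 * 2 ^ p.2 * (g x z.2.1 + 2) ≤
      2 ^ (p.1 + 2) * (4 * 2 ^ p.2) * mass g z.2.1 z.1 z.2.2 x + (z.2.1 + 1)))

section

variable {α : Type*} [Primcodable α]

theorem computable_nat_add {f g : α → ℕ} (hf : Computable f) (hg : Computable g) :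
    Computable fun a => f a + g a := Primrec.nat_add.to_comp.comp hf hg

theorem computable_nat_mul {f g : α → ℕ} (hf : Computable f) (hg : Computable g) :
    Computable fun a => f a * g a := Primrec.nat_mul.to_comp.comp hf hg

theorem computable_two_pow {f : α → ℕ} (hf : Computable f) : Computable fun a => 2 ^ f a :=
  primrec_pow.to_comp.comp (Computable.const 2) hf

theorem computable_and {f g : α → Bool} (hf : Computable f) (hg : Computable g) :
    Computable fun a => f a && g a := Primrec.and.to_comp.comp hf hg

theorem computable_nat_le {f g : α → ℕ} (hf : Computable f) (hg : Computable g) :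
    Computable fun a => decide (f a ≤ g a) := by
  have h : Primrec₂ fun a b : ℕ => decide (a ≤ b) := Primrec.nat_le.decide
  exact h.to_comp.comp hf hg

theorem computable_mem {β : Type*} [Primcodable β] [∀ (x : β) (L : List β), Decidable (x ∈ L)]
    {f : α → β} {g : α → List β} (hf : Computable f) (hg : Computable g) : Computable fun a => decide (f a ∈ g a) := by
  have h : Primrec₂ fun (L : List β) (x : β) => decide (x ∈ L) := primrecRel_mem.decide
  exact h.to_comp.comp hg hf

theorem computable_decide_eq {β : Type*} [Primcodable β] [DecidableEq β] {f g : α → β}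
    (hf : Computable f) (hg : Computable g) : Computable fun a => decide (f a = g a) := by
  have h : Primrec₂ fun (x y : β) => decide (x = y) := Primrec.eq.decide
  exact h.to_comp.comp hf hg

theorem computable_mass {g : List Bool → ℕ → ℕ} (hg : Computable₂ g) {M m : α → ℕ}
    {L : α → List (List Bool)} {x : α → List Bool} (hM : Computable M) (hm : Computable m)
    (hL : Computable L) (hx : Computable x) :
    Computable fun a => mass g (M a) (m a) (L a) (x a) := by
  refine computable_sum_map (primrec_strings.to_comp.comp hm) ?_
  refine Computable.cond (computable_and (computable_mem Computable.snd (hL.comp Computable.fst))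
    (computable_decide_eq ?_ (hx.comp Computable.fst)))
    (hg.comp Computable.snd (hM.comp Computable.fst)) (Computable.const 0)
  exact Primrec.list_take.to_comp.comp
    (Computable.list_length.comp (hx.comp Computable.fst)) Computable.snd

end

theorem computable_scatterTest {g : List Bool → ℕ → ℕ} (hg : Computable₂ g) :
    Computable₂ (scatterTest g) := by
  have hk : Computable fun q : (ℕ × ℕ) × (ℕ × ℕ × List (List Bool)) => q.1.1 :=
    Computable.fst.comp Computable.fst
  have hn : Computable fun q : (ℕ × ℕ) × (ℕ × ℕ × List (List Bool)) => q.1.2 :=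
    Computable.snd.comp Computable.fst
  have hm : Computable fun q : (ℕ × ℕ) × (ℕ × ℕ × List (List Bool)) => q.2.1 :=
    Computable.fst.comp Computable.snd
  have hM : Computable fun q : (ℕ × ℕ) × (ℕ × ℕ × List (List Bool)) => q.2.2.1 :=
    Computable.fst.comp (Computable.snd.comp Computable.snd)
  have hL : Computable fun q : (ℕ × ℕ) × (ℕ × ℕ × List (List Bool)) => q.2.2.2 :=
    Computable.snd.comp (Computable.snd.comp Computable.snd)
  refine computable_and (computable_nat_le hn hm) (computable_and (computable_nat_le ?_ ?_)
    (computable_all (primrec_strings.to_comp.comp hn) ?_))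
  · exact computable_nat_mul
      (computable_two_pow (computable_nat_add hk (Computable.const 1)))
      (computable_nat_add (computable_mass hg hM hm hL (Computable.const []))
        (computable_nat_mul (Computable.const 2) (computable_two_pow hm)))
  · exact computable_nat_add hM (Computable.const 1)
  · have hA : Computable fun r : ((ℕ × ℕ) × (ℕ × ℕ × List (List Bool))) × List Bool =>
        2 ^ (r.1.1.1 + 2) * (4 * 2 ^ r.1.1.2) :=
      computable_nat_mul
        (computable_two_pow (computable_nat_add (hk.comp Computable.fst) (Computable.const 2)))
        (computable_nat_mul (Computable.const 4) (computable_two_pow (hn.comp Computable.fst)))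
    refine computable_nat_le (computable_nat_add (computable_nat_mul hA ?_)
      (computable_nat_mul ?_ ?_)) (computable_nat_add (computable_nat_mul hA ?_) ?_)
    · exact computable_nat_mul (Computable.const 2) (computable_two_pow (hm.comp Computable.fst))
    · exact computable_nat_mul (Computable.const 4) (computable_two_pow (hn.comp Computable.fst))
    · exact computable_nat_add (hg.comp Computable.snd (hM.comp Computable.fst))
        (Computable.const 2)
    · exact computable_mass hg (hM.comp Computable.fst) (hm.comp Computable.fst)
        (hL.comp Computable.fst) Computable.snd
    · exact computable_nat_add (hM.comp Computable.fst) (Computable.const 1)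

theorem abs_mul_measureReal_sub_mass_le {μ : Measure Cantor} [IsFiniteMeasure μ]
    {g : List Bool → ℕ → ℕ} (hg : ∀ x (M : ℕ), |((M : ℝ) + 1) * μ.real (interval x) - g x M| ≤ 2)
    (M : ℕ) {m : ℕ} (L : List (List Bool)) {x : List Bool} (hx : x.length ≤ m) :
    |((M : ℝ) + 1) * μ.real (interval x ∩ cylinder m (· ∈ L)) - mass g M m L x| ≤ 2 * 2 ^ m := by
  have h1 : (mass g M m L x : ℝ) =
      ∑ u ∈ level m, if u ∈ L ∧ u.take x.length = x then (g u M : ℝ) else 0 := by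
    rw [level, List.sum_toFinset _ (nodup_strings m), mass, Nat.cast_list_sum, List.map_map]
    congr 1
    refine List.map_congr_left fun u _ => ?_
    by_cases h : u ∈ L ∧ u.take x.length = x
    · simp [h]
    · rw [if_neg h]
      simp only [not_and_or] at h
      rcases h with h | h <;> simp [h]
  rw [interval_inter_cylinder hx, measureReal_cylinder, h1, Finset.mul_sum,
    ← Finset.sum_sub_distrib]
  refine (Finset.abs_sum_le_sum_abs _ _).trans ?_
  refine (Finset.sum_le_card_nsmul _ _ 2 fun u _ => ?_).trans_eq ?_
  · split_ifs
    · exact hg u M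
    · simp
  · simp [mul_comm]

/-- Soundness of the test: its inequalities retain the required bounds after the worst-case errors,
`2` for one interval and `2 * 2 ^ z.1` for a mass. -/
theorem scatterTest_spec {μ : Measure Cantor} [IsFiniteMeasure μ] {g : List Bool → ℕ → ℕ}
    (hg : ∀ x (M : ℕ), |((M : ℝ) + 1) * μ.real (interval x) - g x M| ≤ 2) {k n : ℕ}
    {z : ℕ × ℕ × List (List Bool)} (h : scatterTest g (k, n) z) :
    n ≤ z.1 ∧ μ.real (cylinder z.1 (· ∈ z.2.2)) ≤ (1 / 2) ^ (k + 1) ∧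
      ∀ x : List Bool, x.length = n →
        (1 / 2) ^ (k + 2) * (μ.real (interval x) - 1 / 4 / 2 ^ n) ≤
          μ.real (interval x ∩ cylinder z.1 (· ∈ z.2.2)) := by
  obtain ⟨m, M, L⟩ := z
  simp only [scatterTest, Bool.and_eq_true, decide_eq_true_eq, List.all_eq_true, mem_strings] at h
  obtain ⟨hnm, hup, hlow⟩ := h
  have hM : (0 : ℝ) < (M : ℝ) + 1 := by positivity
  refine ⟨hnm, ?_, fun x hx => ?_⟩
  · have h1 := (abs_le.1 (abs_mul_measureReal_sub_mass_le hg M (m := m) L (x := []) (by simp))).2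
    have h2 : interval [] ∩ cylinder m (· ∈ L) = cylinder m (· ∈ L) :=
      Set.inter_eq_right.2 fun ω _ => by simp [mem_interval, pre]
    rw [h2] at h1
    have h3 : (2 : ℝ) ^ (k + 1) * (mass g M m L [] + 2 * 2 ^ m) ≤ M + 1 := by exact_mod_cast hup
    rw [one_div_pow, le_div_iff₀ (by positivity)]
    refine le_of_mul_le_mul_left ?_ hM
    calc ((M : ℝ) + 1) * (μ.real (cylinder m (· ∈ L)) * 2 ^ (k + 1))
        = 2 ^ (k + 1) * ((M + 1) * μ.real (cylinder m (· ∈ L))) := by ring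
      _ ≤ 2 ^ (k + 1) * (mass g M m L [] + 2 * 2 ^ m) := by gcongr; linarith
      _ ≤ _ := by rw [mul_one]; exact h3
  · have h1 := (abs_le.1 (abs_mul_measureReal_sub_mass_le hg M (m := m) L (x := x)
      (hx.le.trans hnm))).1
    have h2 := (abs_le.1 (hg x M)).2
    have h3 : (2 : ℝ) ^ (k + 2) * (4 * 2 ^ n) * (2 * 2 ^ m) + 4 * 2 ^ n * (g x M + 2) ≤
        2 ^ (k + 2) * (4 * 2 ^ n) * mass g M m L x + (M + 1) := by exact_mod_cast hlow x hx
    set A := μ.real (interval x ∩ cylinder m (· ∈ L))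
    set I := μ.real (interval x)
    have h4 : (4 * 2 ^ n : ℝ) * ((M + 1) * I) ≤ 4 * 2 ^ n * (g x M + 2) := by gcongr; linarith
    have h5 : (2 : ℝ) ^ (k + 2) * (4 * 2 ^ n) * (mass g M m L x - 2 * 2 ^ m) ≤
        2 ^ (k + 2) * (4 * 2 ^ n) * ((M + 1) * A) := by gcongr; linarith
    have h6 : ((M : ℝ) + 1) * (4 * 2 ^ n * I - 1) ≤ (M + 1) * (2 ^ (k + 2) * (4 * 2 ^ n) * A) := by
      linarith
    have h7 := le_of_mul_le_mul_left h6 hM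
    calc (1 / 2) ^ (k + 2) * (I - 1 / 4 / 2 ^ n)
        = (4 * 2 ^ n * I - 1) / (2 ^ (k + 2) * (4 * 2 ^ n)) := by
          rw [one_div_pow]; field_simp
      _ ≤ A := by rw [div_le_iff₀ (by positivity)]; linarith

/-- Completeness: a set satisfying the bounds with room to spare passes once the precision `M` is
high enough, so the search terminates. -/
theorem exists_scatterTest {μ : Measure Cantor} [IsProbabilityMeasure μ]
    (hna : ∀ ω : Cantor, μ {ω} = 0) {g : List Bool → ℕ → ℕ}
    (hg : ∀ x (M : ℕ), |((M : ℝ) + 1) * μ.real (interval x) - g x M| ≤ 2) (p : ℕ × ℕ) :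
    ∃ z, scatterTest g p z := by
  obtain ⟨k, n⟩ := p
  -- The fraction is half of the allowed `(1 / 2) ^ (k + 1)`, and `ε` half of the tolerated error;
  -- the other halves pay for rounding.
  obtain ⟨m, hnm, L, hL⟩ := exists_cylinder_fraction μ hna (w := (1 / 2) ^ (k + 2))
    (ε := (1 / 2) ^ (k + 2) / (8 * 2 ^ n)) (by positivity)
    (pow_le_one₀ (by norm_num) (by norm_num)) (by positivity) n
  have htot : μ.real (cylinder m (· ∈ L)) ≤ (1 / 2) ^ (k + 2) := by
    calc _ = ∑ x ∈ level n, μ.real (interval x ∩ cylinder m (· ∈ L)) :=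
          measureReal_eq_sum_level μ n (measurableSet_cylinder _ _)
      _ ≤ ∑ x ∈ level n, (1 / 2) ^ (k + 2) * μ.real (interval x) :=
          Finset.sum_le_sum fun x hx => (hL x (mem_level.1 hx)).2
      _ = (1 / 2) ^ (k + 2) := by
          rw [← Finset.mul_sum]
          have := measureReal_eq_sum_level μ n MeasurableSet.univ
          simp only [Set.inter_univ, probReal_univ] at this
          rw [← this, mul_one]
  set D : ℝ := 2 ^ (k + 2) * (4 * 2 ^ n) with hD
  obtain ⟨M, hM⟩ := exists_nat_ge (2 * (D * (4 * 2 ^ m) + 16 * 2 ^ n))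
  refine ⟨(m, M, L), ?_⟩
  simp only [scatterTest, Bool.and_eq_true, decide_eq_true_eq, List.all_eq_true, mem_strings]
  refine ⟨hnm, ?_, fun x hx => ?_⟩
  · have h1 := (abs_le.1 (abs_mul_measureReal_sub_mass_le hg M (m := m) L (x := []) (by simp))).1
    have h2 : interval [] ∩ cylinder m (· ∈ L) = cylinder m (· ∈ L) :=
      Set.inter_eq_right.2 fun ω _ => by simp [mem_interval, pre]
    rw [h2] at h1
    have h3 : (2 : ℝ) ^ (k + 1) * (mass g M m L [] + 2 * 2 ^ m) ≤ M + 1 := by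
      have h4 : ((M : ℝ) + 1) * μ.real (cylinder m (· ∈ L)) ≤ (M + 1) * (1 / 2) ^ (k + 2) := by
        gcongr
      have h5 : (2 : ℝ) ^ (k + 1) * ((M + 1) * (1 / 2) ^ (k + 2)) = (M + 1) / 2 := by
        rw [one_div_pow, pow_succ 2 (k + 1)]; field_simp
      have h6 : (2 : ℝ) ^ (k + 1) * (mass g M m L [] + 2 * 2 ^ m) ≤
          2 ^ (k + 1) * ((M + 1) * (1 / 2) ^ (k + 2) + 4 * 2 ^ m) :=
        mul_le_mul_of_nonneg_left (by linarith) (by positivity)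
      have h7 : (2 : ℝ) ^ (k + 1) * (4 * 2 ^ m) ≤ D * (4 * 2 ^ m) := by
        have : (1 : ℝ) ≤ 2 ^ n := one_le_pow₀ (by norm_num)
        rw [hD]
        gcongr
        calc (2 : ℝ) ^ (k + 1) ≤ 2 ^ (k + 2) := by gcongr <;> norm_num
          _ ≤ _ := le_mul_of_one_le_right (by positivity) (by linarith)
      have h8 : (0 : ℝ) < 16 * 2 ^ n := by positivity
      linarith
    exact_mod_cast h3
  · have h1 := (abs_le.1 (abs_mul_measureReal_sub_mass_le hg M (m := m) L (x := x)
      (hx.le.trans hnm))).2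
    have h2 := (abs_le.1 (hg x M)).1
    have hlow := (hL x hx).1
    have h3 : (2 : ℝ) ^ (k + 2) * (4 * 2 ^ n) * (2 * 2 ^ m) + 4 * 2 ^ n * (g x M + 2) ≤
        2 ^ (k + 2) * (4 * 2 ^ n) * mass g M m L x + (M + 1) := by
      rw [← hD]
      set A := μ.real (interval x ∩ cylinder m (· ∈ L))
      set I := μ.real (interval x)
      have h4 : (4 * 2 ^ n : ℝ) * I - 1 / 2 ≤ D * A := by
        calc (4 * 2 ^ n : ℝ) * I - 1 / 2
            = D * ((1 / 2) ^ (k + 2) * I - (1 / 2) ^ (k + 2) / (8 * 2 ^ n)) := by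
              rw [hD, one_div_pow]; field_simp; ring
          _ ≤ _ := by gcongr
      have h5 : ((M : ℝ) + 1) * ((4 * 2 ^ n : ℝ) * I - 1 / 2) ≤ (M + 1) * (D * A) := by gcongr
      have h6 : D * ((M + 1) * A - 2 * 2 ^ m) ≤ D * mass g M m L x := by gcongr; linarith
      have h7 : (4 * 2 ^ n : ℝ) * (g x M) ≤ 4 * 2 ^ n * ((M + 1) * I + 2) := by gcongr; linarith
      linarith
    exact_mod_cast h3

/-- Every computable non-atomic measure has a computable sequence of small sets, each of them
scattered over the intervals on which the previous one is determined. -/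
theorem exists_computable_scattered {μ : Measure Cantor} [IsProbabilityMeasure μ]
    (hμ : ComputableMeasure μ) (hna : ∀ ω : Cantor, μ {ω} = 0) :
    ∃ F : ℕ → ℕ × List (List Bool), Computable F ∧ Monotone (fun k => (F k).1) ∧
      (∀ k, μ.real (cylinder (F k).1 (· ∈ (F k).2)) ≤ (1 / 2) ^ (k + 1)) ∧
      ∀ k P, (1 / 2 : ℝ) ^ (k + 3) * (μ.real (cylinder (F k).1 P) - 1 / 4) ≤
        μ.real (cylinder (F k).1 P ∩ cylinder (F (k + 1)).1 (· ∈ (F (k + 1)).2)) := by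
  obtain ⟨g, hgc, hg⟩ := hμ.exists_nat_approx
  obtain ⟨f, hf, hfs⟩ := exists_computable_choice (computable_scatterTest hgc)
    (exists_scatterTest hna hg)
  -- The length found at one scale is the length over which the next set must be scattered.
  obtain ⟨G, hG, hG0, hG1⟩ : ∃ G : ℕ → ℕ × ℕ × List (List Bool), Computable G ∧
      scatterTest g (0, 0) (G 0) ∧ ∀ k, scatterTest g (k + 1, (G k).1) (G (k + 1)) := by
    refine ⟨fun k => Nat.rec (f (0, 0)) (fun i z => f (i + 1, z.1)) k, ?_, hfs _, fun k => hfs _⟩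
    have hstep : Computable₂ fun (_ : ℕ) (p : ℕ × ℕ × ℕ × List (List Bool)) =>
        f (p.1 + 1, p.2.1) :=
      hf.comp ((Computable.succ.comp (Computable.fst.comp Computable.snd)).pair
        (Computable.fst.comp (Computable.snd.comp Computable.snd)))
    exact Computable.nat_rec Computable.id (Computable.const _) hstep
  refine ⟨fun k => ((G k).1, (G k).2.2), (Computable.fst.comp hG).pair
    (Computable.snd.comp (Computable.snd.comp hG)),
    monotone_nat_of_le_succ fun k => (scatterTest_spec hg (hG1 k)).1, fun k => ?_, fun k P => ?_⟩
  · cases k with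
    | zero => exact (scatterTest_spec hg hG0).2.1
    | succ k => exact (scatterTest_spec hg (hG1 k)).2.1
  · exact measureReal_inter_cylinder_ge μ (measurableSet_cylinder _ _) (by positivity)
      (by norm_num) (scatterTest_spec hg (hG1 k)).2.2 P

/-! ### The function given by a computable sequence of small sets -/

/-- The largest `2 ^ k` such that `ω` belongs to the `k`-th of the sets coded by `F`. -/
noncomputable def scaleSup (F : ℕ → ℕ × List (List Bool)) (ω : Cantor) : ℝ≥0∞ :=
  ⨆ (k : ℕ) (_ : pre ω (F k).1 ∈ (F k).2), 2 ^ k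

theorem lt_scaleSup {F : ℕ → ℕ × List (List Bool)} {ω : Cantor} {r : ℝ≥0∞} :
    r < scaleSup F ω ↔ ∃ k, pre ω (F k).1 ∈ (F k).2 ∧ r < 2 ^ k := by
  simp [scaleSup, lt_iSup_iff]

theorem coe_ratVal_lt_two_pow (r : ℕ × ℕ) (k : ℕ) :
    (ratVal r : ℝ≥0∞) < 2 ^ k ↔ r.1 + 1 ≤ 2 ^ k * (r.2 + 1) := by
  have h : (2 : ℝ≥0∞) ^ k = ((2 ^ k : ℝ≥0) : ℝ≥0∞) := by push_cast; rfl
  rw [h, ENNReal.coe_lt_coe, ratVal, div_lt_iff₀ (by positivity), Nat.succ_le_iff]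
  exact_mod_cast Iff.rfl

theorem lowerSemicomputable_scaleSup {F : ℕ → ℕ × List (List Bool)} (hF : Computable F) :
    LowerSemicomputable (scaleSup F) := by
  let p : (ℕ × ℕ) × List Bool → ℕ → Bool := fun q k =>
    decide (q.2.length = (F k).1) && (decide (q.2 ∈ (F k).2) &&
      decide (q.1.1 + 1 ≤ 2 ^ k * (q.1.2 + 1)))
  have hp : Computable₂ p := by
    have hx : Computable fun q : ((ℕ × ℕ) × List Bool) × ℕ => q.1.2 :=
      Computable.snd.comp Computable.fst
    have hr : Computable fun q : ((ℕ × ℕ) × List Bool) × ℕ => q.1.1 :=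
      Computable.fst.comp Computable.fst
    have hFk : Computable fun q : ((ℕ × ℕ) × List Bool) × ℕ => F q.2 := hF.comp Computable.snd
    exact computable_and
      (computable_decide_eq (Computable.list_length.comp hx) (Computable.fst.comp hFk))
      (computable_and (computable_mem hx (Computable.snd.comp hFk))
        (computable_nat_le
          (computable_nat_add (Computable.fst.comp hr) (Computable.const 1))
          (computable_nat_mul (computable_two_pow Computable.snd)
            (computable_nat_add (Computable.snd.comp hr) (Computable.const 1)))))
  refine ⟨fun q => ∃ k, p q k, rePred_exists_nat hp, fun r => ?_⟩
  ext ω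
  simp only [p, Set.mem_ofPred_eq, lt_scaleSup, Set.mem_iUnion, Bool.and_eq_true,
    decide_eq_true_eq, exists_prop, coe_ratVal_lt_two_pow]
  constructor
  · rintro ⟨k, h1, h2⟩
    exact ⟨pre ω (F k).1, ⟨k, by simp, h1, h2⟩, mem_interval_pre _ _⟩
  · rintro ⟨x, ⟨k, h1, h2, h3⟩, h4⟩
    refine ⟨k, ?_, h3⟩
    rwa [← h1, mem_interval.1 h4]

/-- Only the sets with `2 ^ k > r` matter. Thanks to the extra factor `1 / 2`, their measures sum to
at most `2 ^ (-k₁)` for the first such index `k₁`. -/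
theorem probabilityBounded_scaleSup {μ : Measure Cantor} [IsFiniteMeasure μ]
    {F : ℕ → ℕ × List (List Bool)}
    (hF : ∀ k, μ.real (cylinder (F k).1 (· ∈ (F k).2)) ≤ (1 / 2) ^ (k + 1)) :
    ProbabilityBounded μ (scaleSup F) := by
  classical
  intro r _
  have hex : ∃ k : ℕ, (ratVal r : ℝ≥0∞) < 2 ^ k := by
    obtain ⟨k, hk⟩ := pow_unbounded_of_one_lt (ratVal r) (one_lt_two (α := ℝ≥0))
    exact ⟨k, by exact_mod_cast hk⟩
  set k₁ := Nat.find hex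
  have hsub : {ω | (ratVal r : ℝ≥0∞) < scaleSup F ω} ⊆
      ⋃ j, cylinder (F (k₁ + j)).1 (· ∈ (F (k₁ + j)).2) := by
    intro ω hω
    obtain ⟨k, h1, h2⟩ := lt_scaleSup.1 hω
    obtain ⟨j, rfl⟩ := Nat.exists_eq_add_of_le (Nat.find_min' hex h2)
    exact Set.mem_iUnion.2 ⟨j, h1⟩
  have hFμ : ∀ k, μ (cylinder (F k).1 (· ∈ (F k).2)) ≤ 2⁻¹ ^ (k + 1) := by
    intro k
    have := ENNReal.ofReal_le_ofReal (hF k)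
    rw [Measure.real, ENNReal.ofReal_toReal (measure_ne_top _ _),
      ENNReal.ofReal_pow (by norm_num), one_div, ENNReal.ofReal_inv_of_pos two_pos] at this
    simpa using this
  calc _ ≤ _ := measure_mono hsub
    _ ≤ _ := measure_iUnion_le _
    _ ≤ ∑' j, 2⁻¹ ^ k₁ * 2⁻¹ ^ (j + 1) := ENNReal.tsum_le_tsum fun j => by
        rw [← pow_add, ← add_assoc]; exact hFμ _
    _ = (2 ^ k₁)⁻¹ := by
        rw [ENNReal.tsum_mul_left, ENNReal.tsum_geometric_add_one, ENNReal.one_sub_inv_two,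
          inv_inv, ENNReal.inv_mul_cancel two_ne_zero ENNReal.ofNat_ne_top, mul_one,
          ENNReal.inv_pow]
    _ ≤ _ := ENNReal.inv_le_inv.2 (Nat.find_spec hex).le

theorem ProbabilityBounded.ae_ne_top {μ : Measure Cantor} {t : Cantor → ℝ≥0∞}
    (ht : ProbabilityBounded μ t) : ∀ᵐ ω ∂μ, t ω ≠ ⊤ := by
  rw [ae_iff]
  simp only [not_not]
  refine le_antisymm (ENNReal.le_of_forall_pos_le_add fun ε hε _ => ?_) bot_le
  obtain ⟨n, hn⟩ := exists_nat_gt ε⁻¹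
  have hn' : ratVal (n, 0) = n := by simp [ratVal]
  have hn0 : (0 : ℝ≥0) < n := bot_le.trans_lt hn
  have h := ht (n, 0) (by rwa [hn'])
  rw [hn'] at h
  refine (measure_mono fun ω hω => ?_).trans (h.trans ?_)
  · rw [Set.mem_ofPred_eq] at hω ⊢
    rw [hω]; exact ENNReal.coe_lt_top
  · rw [zero_add, ← ENNReal.coe_inv hn0.ne', ENNReal.coe_le_coe]
    exact inv_le_of_inv_le₀ hε hn.le

/-! ### Logarithms -/

theorem log2_eq_logb {x : ℝ≥0∞} (h0 : x ≠ 0) (h : x ≠ ⊤) :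
    log2 x = (Real.logb 2 x.toReal : ℝ) := by
  rw [log2, ENNReal.log_pos_real h0 h, ← EReal.coe_div]
  rfl

theorem log2_zero : log2 0 = ⊥ := by
  rw [log2, ENNReal.log_zero]
  exact EReal.bot_div_of_pos_ne_top (by exact_mod_cast Real.log_pos one_lt_two)
    (EReal.coe_ne_top _)

theorem neg_log2_sub_KA_le {μ : Measure Cantor} [IsFiniteMeasure μ] {a : List Bool → ℝ≥0∞}
    {l : ℝ≥0} {x : List Bool} (h : a x < l * μ (interval x)) :
    -log2 (μ (interval x)) - KA a x ≤ (Real.logb 2 l : ℝ) := by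
  have hμ0 : μ (interval x) ≠ 0 := by rintro h0; simp [h0] at h
  have hl0 : l ≠ 0 := by rintro rfl; simp at h
  have hμt : μ (interval x) ≠ ⊤ := measure_ne_top _ _
  rw [KA, log2_eq_logb hμ0 hμt]
  -- When `a x = 0`, `KA a x` is `⊤` and the difference is `⊥`.
  rcases eq_or_ne (a x) 0 with ha | ha
  · rw [ha, log2_zero, EReal.neg_bot, EReal.sub_top]
    exact bot_le
  · rw [log2_eq_logb ha h.ne_top]
    have h1 : (a x).toReal ≤ l * (μ (interval x)).toReal := by
      have := ENNReal.toReal_mono (ENNReal.mul_ne_top ENNReal.coe_ne_top hμt) h.le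
      simpa using this
    have ha' : 0 < (a x).toReal := ENNReal.toReal_pos ha h.ne_top
    have h2 := Real.logb_le_logb_of_le one_lt_two ha' h1
    rw [Real.logb_mul (by exact_mod_cast hl0) (ENNReal.toReal_pos hμ0 hμt).ne'] at h2
    norm_cast
    linarith

/-- Up to `k + 1` the logarithm of `d` is at most `logb 2 (k + 1)`; beyond, it grows with slope at
most `1 / ((k + 1) log 2) ≤ 1`, so `d - logb 2 d` does not fall below its value at `k + 1`. -/
theorem sub_logb_le_sub_logb {k : ℕ} (hk : 1 ≤ k) {γ d : ℝ} (hγ : 0 ≤ γ) (hd : 0 < d)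
    (h : k - γ ≤ d) : k - Real.logb 2 (k + 1) - γ ≤ d - Real.logb 2 d := by
  have hk0 : (0 : ℝ) < k + 1 := by positivity
  have hk1 : (1 : ℝ) ≤ k := by exact_mod_cast hk
  rcases le_total d (k + 1) with hdk | hdk
  · linarith [Real.logb_le_logb_of_le one_lt_two hd hdk]
  · have h1 : Real.logb 2 d - Real.logb 2 (k + 1) ≤ d - (k + 1) := by
      rw [← Real.logb_div hd.ne' hk0.ne', Real.logb, div_le_iff₀ (Real.log_pos one_lt_two)]
      calc Real.log (d / (k + 1)) ≤ d / (k + 1) - 1 := Real.log_le_sub_one_of_pos (by positivity)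
        _ = (d - (k + 1)) * (1 / (k + 1)) := by field_simp
        _ ≤ (d - (k + 1)) * Real.log 2 := by
          have h2 : 1 / ((k : ℝ) + 1) ≤ 1 / 2 := by gcongr; linarith
          exact mul_le_mul_of_nonneg_left (h2.trans (by linarith [Real.log_two_gt_d9]))
            (by linarith)
    linarith

end RandomnessDeficiency

/-! ### The main theorem -/

open RandomnessDeficiency in
theorem mainTheorem2 (μ : MeasureTheory.Measure Cantor) [MeasureTheory.IsProbabilityMeasure μ]
    (hμ : ComputableMeasure μ) (hna : ∀ ω : Cantor, μ {ω} = 0)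
    (t : Cantor → ℝ≥0∞) (ht : IsLargestProbabilityBounded μ t)
    (a : List Bool → ℝ≥0∞) (ha : IsAPrioriProbability a) (c : ℝ) :
    ∃ (ω : Cantor) (d : ℝ), dP t ω = (d : EReal) ∧ 1 < d ∧
      dA μ a ω < ((d - Real.logb 2 d - c : ℝ) : EReal) := by
  obtain ⟨F, hFc, hFm, hup, hlow⟩ := exists_computable_scattered hμ hna
  obtain ⟨C, hC⟩ := ht.largest (scaleSup F) (lowerSemicomputable_scaleSup hFc)
    (probabilityBounded_scaleSup hup)
  -- The maximum with `1` makes `γ` nonnegative and covers `C = 0`.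
  set γ : ℝ := Real.logb 2 (max C 1 : ℝ≥0) with hγ
  have hγ0 : 0 ≤ γ := Real.logb_nonneg one_lt_two (by exact_mod_cast le_max_right C 1)
  -- With `k ≥ γ + 2` the deficiency is at least `k - γ ≥ 2 > 1`.
  obtain ⟨k₀, hk₀⟩ := exists_nat_ge (γ + 2)
  -- `c` is the required gap, `γ` the loss from the largest function's constant, and `1` makes the
  -- final inequality strict.
  let B : ℝ≥0 := 2 ^ (c + γ + 1)
  have hB : 0 < B := NNReal.rpow_pos two_pos
  have hBlog : Real.logb 2 B = c + γ + 1 := by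
    simp only [B, NNReal.coe_rpow, NNReal.coe_ofNat]
    exact Real.logb_rpow two_pos (by norm_num)
  obtain ⟨ω, ⟨k, hk, hmem, hlt⟩, htop⟩ := ((frequently_not_covered μ ha.isContinuousSemimeasure.2
    hFm (fun k => (· ∈ (F k).2)) hup hlow hB k₀).and_eventually
      ht.probabilityBounded.ae_ne_top).exists
  have hk' : γ + 2 ≤ k := hk₀.trans (by exact_mod_cast hk)
  have h1 : (2 : ℝ≥0∞) ^ k ≤ (max C 1 : ℝ≥0) * t ω :=
    calc (2 : ℝ≥0∞) ^ k ≤ scaleSup F ω := le_iSup₂_of_le k hmem le_rfl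
      _ ≤ C * t ω := hC ω
      _ ≤ _ := by gcongr; exact le_max_left _ _
  have ht0 : t ω ≠ 0 := by
    intro h0
    rw [h0, mul_zero] at h1
    exact absurd h1 (by simp)
  have htpos := ENNReal.toReal_pos ht0 htop
  have h2 : (2 : ℝ) ^ k ≤ (max C 1 : ℝ≥0) * (t ω).toReal := by
    have := ENNReal.toReal_mono (ENNReal.mul_ne_top ENNReal.coe_ne_top htop) h1
    simpa only [ENNReal.toReal_pow, ENNReal.toReal_mul, ENNReal.toReal_ofNat,
      ENNReal.coe_toReal] using this
  have hCpos : (0 : ℝ) < (max C 1 : ℝ≥0) := by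
    exact_mod_cast zero_lt_one.trans_le (le_max_right C 1)
  have h3 : (k : ℝ) - γ ≤ Real.logb 2 (t ω).toReal := by
    have := Real.logb_le_logb_of_le one_lt_two (by positivity) h2
    rw [Real.logb_mul hCpos.ne' htpos.ne', Real.logb_pow, Real.logb_self_eq_one one_lt_two,
      mul_one] at this
    linarith
  refine ⟨ω, Real.logb 2 (t ω).toReal, log2_eq_logb ht0 htop, by linarith, ?_⟩
  have h4 : dA μ a ω ≤ (Real.logb 2 (ratio B k) : ℝ) :=
    iSup_le fun n => neg_log2_sub_KA_le (hlt n)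
  refine h4.trans_lt (EReal.coe_lt_coe_iff.2 ?_)
  have h5 : Real.logb 2 (ratio B k) = k - (c + γ + 1 + Real.logb 2 (k + 1)) := by
    have hB' : (B : ℝ) ≠ 0 := by exact_mod_cast hB.ne'
    simp only [ratio]
    push_cast
    rw [Real.logb_div (by positivity) (by positivity), Real.logb_mul hB' (by positivity), hBlog,
      Real.logb_pow, Real.logb_self_eq_one one_lt_two, mul_one]
  have h6 := sub_logb_le_sub_logb (k := k) (by
    have : (1 : ℝ) ≤ k := by linarith
    exact_mod_cast this) hγ0 (by linarith) h3
  linarith
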